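/- Let $n\ge 2$ be an integer and let $a$ be a real number with $\max\{-1,2-n\}<a<1$. Write $\mathbb{R}^n_+=\{x=(x',x_n)\in\mathbb{R}^n : x_n>0\}$ and $\overline{\mathbb{R}^n_+}=\{x\in\mathbb{R}^n : x_n\ge 0\}$. Let $u\in C^2(\mathbb{R}^n_+)\cap C^1(\overline{\mathbb{R}^n_+})$ be a real-valued function such that $u>0$ and $\operatorname{div}(x_n^a\nabla u)=0$ in $\mathbb{R}^n_+$, and such that $$\lim_{x_n\to 0^+} x_n^a\,\frac{\partial u}{\partial x_n}(x',x_n)=0\qquad\text{for every } x'\in\mathbb{R}^{n-1}.$$ Then there is a constant $C>0$ such that $u(x)=C$ for all $x\in\overline{\mathbb{R}^n_+}$. -/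

import Mathlib

open Filter Topology

noncomputable section

namespace HalfSpace

/-- The index of the last coordinate `x_n` of `ℝⁿ` (coordinates are numbered from `0`). -/
def lastIdx (n : ℕ) (hn : 2 ≤ n) : Fin n := ⟨n - 1, by omega⟩

/-- The open upper half space: all `x` in `ℝⁿ` with `x_n > 0`. -/
def upper (n : ℕ) (hn : 2 ≤ n) : Set (EuclideanSpace ℝ (Fin n)) :=
  {x | 0 < x (lastIdx n hn)}

/-- The closed upper half space: all `x` in `ℝⁿ` with `x_n ≥ 0`. -/
def closedUpper (n : ℕ) (hn : 2 ≤ n) : Set (EuclideanSpace ℝ (Fin n)) :=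
  {x | 0 ≤ x (lastIdx n hn)}

/-- The partial derivative of `f` in the direction of the `i`-th coordinate. -/
def partialDeriv {n : ℕ} (i : Fin n) (f : EuclideanSpace ℝ (Fin n) → ℝ)
    (x : EuclideanSpace ℝ (Fin n)) : ℝ :=
  fderiv ℝ f x (EuclideanSpace.single i 1)

/-- The divergence of a vector field on `ℝⁿ`: the sum of the derivatives `∂_i F_i`. -/
def divergence {n : ℕ} (F : EuclideanSpace ℝ (Fin n) → EuclideanSpace ℝ (Fin n))
    (x : EuclideanSpace ℝ (Fin n)) : ℝ :=
  ∑ i, partialDeriv i (fun y => F y i) x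

end HalfSpace

end

/-! Put k = n - 2 + a, which is positive because a > 2 - n. In the open half space the equation
reads x_N Δu + a ∂_N u = 0. It is preserved by Kelvin transforms centred on the boundary hyperplane
(`HasWeightedLaplacian.kelvin`), and so is the Neumann condition in its integrated form u(x + t e_N)
- u(x) = o(t^(1-a)) (`kelvin_vertical_isLittleO`). Once normalised, the transform agrees with u on
the sphere of inversion and decays like |y|^(-k) at infinity, while u ≥ 0. The maximum principle
therefore puts it below u outside the sphere, for every centre and every radius (`kelvin_le`).

Given y and z with y_N < z_N, let the centre be the point where their line meets the hyperplane, and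
choose the radius so that the inversion swaps y and z. The comparison becomes (y_N / z_N)^(k/2) u(y)
≤ u(z) (`rpow_mul_le`). The factor involves only the heights and tends to 1 as they merge, so u
depends on x_N alone (`eq_of_height_eq`). The equation then says that the flux t^a u'(t) is
constant, and the Neumann condition makes it zero (`vertical_const`). -/

open Filter Topology

noncomputable section

namespace HalfSpace

/-! ### Calculus of pointwise second derivatives in one variable. -/

/-- `f` is twice differentiable at `x` with first derivative `f'` and second derivative `f''`. -/
def HasDeriv2At {F : Type*} [NormedAddCommGroup F] [NormedSpace ℝ F]
    (f : ℝ → F) (f' f'' : F) (x : ℝ) : Prop :=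
  ∃ g : ℝ → F, (∀ᶠ s in 𝓝 x, HasDerivAt f (g s) s) ∧ g x = f' ∧ HasDerivAt g f'' x

namespace HasDeriv2At

variable {F : Type*} [NormedAddCommGroup F] [NormedSpace ℝ F] {x : ℝ}

theorem hasDerivAt {f : ℝ → F} {f' f'' : F} (h : HasDeriv2At f f' f'' x) : HasDerivAt f f' x := by
  obtain ⟨g, hg, rfl, -⟩ := h
  exact hg.self_of_nhds

theorem congr_deriv {f : ℝ → F} {f' f'' g' g'' : F} (h : HasDeriv2At f f' f'' x)
    (h' : f' = g') (h'' : f'' = g'') : HasDeriv2At f g' g'' x := h' ▸ h'' ▸ h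

theorem const (c : F) : HasDeriv2At (fun _ => c) 0 0 x :=
  ⟨fun _ => 0, .of_forall fun s => hasDerivAt_const s c, rfl, hasDerivAt_const x 0⟩

theorem affine (p e : F) : HasDeriv2At (fun s : ℝ => p + s • e) e 0 x :=
  ⟨fun _ => e, .of_forall fun s => by simpa using ((hasDerivAt_id s).smul_const e).const_add p,
    rfl, hasDerivAt_const x e⟩

theorem add {f h : ℝ → F} {f' f'' h' h'' : F} (hf : HasDeriv2At f f' f'' x)
    (hh : HasDeriv2At h h' h'' x) :
    HasDeriv2At (fun s => f s + h s) (f' + h') (f'' + h'') x := by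
  obtain ⟨g, hg, rfl, hg'⟩ := hf
  obtain ⟨k, hk, rfl, hk'⟩ := hh
  exact ⟨fun s => g s + k s, (hg.and hk).mono fun s hs => hs.1.add hs.2, rfl, hg'.add hk'⟩

theorem sub {f h : ℝ → F} {f' f'' h' h'' : F} (hf : HasDeriv2At f f' f'' x)
    (hh : HasDeriv2At h h' h'' x) :
    HasDeriv2At (fun s => f s - h s) (f' - h') (f'' - h'') x := by
  obtain ⟨g, hg, rfl, hg'⟩ := hf
  obtain ⟨k, hk, rfl, hk'⟩ := hh
  exact ⟨fun s => g s - k s, (hg.and hk).mono fun s hs => hs.1.sub hs.2, rfl, hg'.sub hk'⟩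

theorem smul {f : ℝ → ℝ} {h : ℝ → F} {f' f'' : ℝ} {h' h'' : F} (hf : HasDeriv2At f f' f'' x)
    (hh : HasDeriv2At h h' h'' x) :
    HasDeriv2At (fun s => f s • h s) (f x • h' + f' • h x)
      (f x • h'' + (2 : ℝ) • f' • h' + f'' • h x) x := by
  have hfx := hf.hasDerivAt
  have hhx := hh.hasDerivAt
  obtain ⟨g, hg, rfl, hg'⟩ := hf
  obtain ⟨k, hk, rfl, hk'⟩ := hh
  refine ⟨fun s => f s • k s + g s • h s, (hg.and hk).mono fun s hs => hs.1.smul hs.2, rfl, ?_⟩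
  refine ((hfx.smul hk').add (hg'.smul hhx)).congr_deriv ?_
  rw [two_smul]; abel

theorem const_smul {h : ℝ → F} {h' h'' : F} (c : ℝ) (hh : HasDeriv2At h h' h'' x) :
    HasDeriv2At (fun s => c • h s) (c • h') (c • h'') x :=
  ((const c).smul hh).congr_deriv (by simp) (by simp)

theorem rpow_const {f : ℝ → ℝ} {f' f'' : ℝ} (hf : HasDeriv2At f f' f'' x) (h0 : 0 < f x) (p : ℝ) :
    HasDeriv2At (fun s => f s ^ p) (f' * p * f x ^ (p - 1))
      (f'' * p * f x ^ (p - 1) + p * (p - 1) * f' ^ 2 * f x ^ (p - 2)) x := by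
  have hfx := hf.hasDerivAt
  obtain ⟨g, hg, rfl, hg'⟩ := hf
  have hpos : ∀ᶠ s in 𝓝 x, 0 < f s := hfx.continuousAt.eventually (lt_mem_nhds h0)
  refine ⟨fun s => g s * p * f s ^ (p - 1), (hg.and hpos).mono fun s hs =>
    hs.1.rpow_const (Or.inl hs.2.ne'), rfl, ?_⟩
  refine ((hg'.mul_const p).mul (hfx.rpow_const (p := p - 1) (Or.inl h0.ne'))).congr_deriv ?_
  rw [show p - 1 - 1 = p - 2 by ring]; ring

theorem comp {E : Type*} [NormedAddCommGroup E] [NormedSpace ℝ E] {u : E → F} {c : ℝ → E}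
    {c' c'' : E} (hu : ContDiffAt ℝ 2 u (c x)) (hc : HasDeriv2At c c' c'' x) :
    HasDeriv2At (fun s => u (c s)) (fderiv ℝ u (c x) c')
      (fderiv ℝ (fderiv ℝ u) (c x) c' c' + fderiv ℝ u (c x) c'') x := by
  have hcx := hc.hasDerivAt
  obtain ⟨g, hg, rfl, hg'⟩ := hc
  have hev : ∀ᶠ y in 𝓝 (c x), DifferentiableAt ℝ u y :=
    (hu.eventually (by simp)).mono fun y hy => hy.differentiableAt (by simp)
  refine ⟨fun s => fderiv ℝ u (c s) (g s), (hg.and (hcx.continuousAt.eventually hev)).mono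
    fun s hs => hs.2.hasFDerivAt.comp_hasDerivAt s hs.1, rfl, ?_⟩
  have hd : DifferentiableAt ℝ (fderiv ℝ u) (c x) :=
    (hu.fderiv_right (m := 1) (by norm_num)).differentiableAt (by simp)
  exact (hd.hasFDerivAt.comp_hasDerivAt x hcx).clm_apply hg'

theorem deriv_eq {f : ℝ → F} {f' f'' : F} (h : HasDeriv2At f f' f'' x) :
    deriv f x = f' ∧ deriv (deriv f) x = f'' := by
  refine ⟨h.hasDerivAt.deriv, ?_⟩
  obtain ⟨g, hg, rfl, hg'⟩ := h
  have : deriv f =ᶠ[𝓝 x] g := hg.mono fun s hs => hs.deriv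
  rw [this.deriv_eq, hg'.deriv]

theorem unique {f : ℝ → F} {f' f'' g' g'' : F} (h : HasDeriv2At f f' f'' x)
    (h' : HasDeriv2At f g' g'' x) : f' = g' ∧ f'' = g'' :=
  ⟨h.deriv_eq.1.symm.trans h'.deriv_eq.1, h.deriv_eq.2.symm.trans h'.deriv_eq.2⟩

/-- If f'' < 0, the second derivative test makes the point a local maximum as well. Then f is
locally constant, which forces f'' = 0. -/
theorem nonneg_of_isLocalMin {f : ℝ → ℝ} {f' f'' : ℝ} (h : HasDeriv2At f f' f'' x)
    (hmin : IsLocalMin f x) : f' = 0 ∧ 0 ≤ f'' := by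
  have h1 : f' = 0 := hmin.hasDerivAt_eq_zero h.hasDerivAt
  refine ⟨h1, ?_⟩
  by_contra! hneg
  obtain ⟨hd, hdd⟩ := h.deriv_eq
  have hmax : IsLocalMax f x := isLocalMax_of_deriv_deriv_neg (hdd ▸ hneg) (hd.trans h1)
    h.hasDerivAt.continuousAt
  have hconst : f =ᶠ[𝓝 x] fun _ => f x := (hmin.and hmax).mono fun s hs => le_antisymm hs.2 hs.1
  have := hconst.deriv.deriv_eq
  simp [hdd] at this
  exact hneg.ne this

end HasDeriv2At

/-! ### The weighted Laplacian, its minimum principle and a barrier. -/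

/-- The function `f` is twice differentiable at `p` along the coordinate lines, and
`x_N ^ (1 - a) * div (x_N ^ a ∇f)`, that is `x_N Δf + a ∂_N f`, takes the value `v` there. -/
def HasWeightedLaplacian {n : ℕ} (a : ℝ) (N : Fin n) (f : EuclideanSpace ℝ (Fin n) → ℝ) (v : ℝ)
    (p : EuclideanSpace ℝ (Fin n)) : Prop :=
  ∃ f' f'' : Fin n → ℝ,
    (∀ i, HasDeriv2At (fun s : ℝ => f (p + s • EuclideanSpace.single i (1 : ℝ))) (f' i) (f'' i) 0) ∧
      p N * ∑ i, f'' i + a * f' N = v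

namespace HasWeightedLaplacian

variable {n : ℕ} {a : ℝ} {N : Fin n} {p : EuclideanSpace ℝ (Fin n)}

theorem sub {f g : EuclideanSpace ℝ (Fin n) → ℝ} {v w : ℝ} (hf : HasWeightedLaplacian a N f v p)
    (hg : HasWeightedLaplacian a N g w p) :
    HasWeightedLaplacian a N (fun y => f y - g y) (v - w) p := by
  obtain ⟨f', f'', hf, rfl⟩ := hf
  obtain ⟨g', g'', hg, rfl⟩ := hg
  refine ⟨fun i => f' i - g' i, fun i => f'' i - g'' i, fun i => (hf i).sub (hg i), ?_⟩
  rw [Finset.sum_sub_distrib]; ring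

theorem const_mul {f : EuclideanSpace ℝ (Fin n) → ℝ} {v : ℝ} (c : ℝ)
    (hf : HasWeightedLaplacian a N f v p) :
    HasWeightedLaplacian a N (fun y => c * f y) (c * v) p := by
  obtain ⟨f', f'', hf, rfl⟩ := hf
  refine ⟨fun i => c * f' i, fun i => c * f'' i, fun i => (hf i).const_smul c, ?_⟩
  rw [← Finset.mul_sum]; ring

/-- The minimum principle: along each coordinate line the first derivative vanishes and the second
is nonnegative, so the first-order term drops out. -/
theorem nonneg_of_isLocalMin {f : EuclideanSpace ℝ (Fin n) → ℝ} {v : ℝ}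
    (hf : HasWeightedLaplacian a N f v p) (hp : 0 ≤ p N) (hmin : IsLocalMin f p) : 0 ≤ v := by
  obtain ⟨f', f'', hf, rfl⟩ := hf
  have key (i : Fin n) : f' i = 0 ∧ 0 ≤ f'' i := by
    refine (hf i).nonneg_of_isLocalMin ?_
    have hc : Tendsto (fun s : ℝ => p + s • EuclideanSpace.single i (1 : ℝ)) (𝓝 0) (𝓝 p) := by
      have : Continuous fun s : ℝ => p + s • EuclideanSpace.single i (1 : ℝ) := by fun_prop
      simpa using this.tendsto 0
    simpa [IsLocalMin, IsMinFilter] using hc.eventually hmin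
  rw [(key N).1]
  have := Finset.sum_nonneg fun i (_ : i ∈ Finset.univ) => (key i).2
  nlinarith [mul_nonneg hp this]

/-- A function of `x_N` alone. -/
theorem of_height {b : ℝ → ℝ} {b' b'' : ℝ} (hb : HasDeriv2At b b' b'' (p N)) :
    HasWeightedLaplacian a N (fun y => b (y N)) (p N * b'' + a * b') p := by
  refine ⟨fun i => if i = N then b' else 0, fun i => if i = N then b'' else 0, fun i => ?_, by simp⟩
  by_cases hi : i = N
  · subst hi
    obtain ⟨g, hg, rfl, hg'⟩ := hb
    have hshift (s : ℝ) : HasDerivAt (fun s => p i + s) 1 s := (hasDerivAt_id s).const_add _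
    have ht : Tendsto (fun s => p i + s) (𝓝 0) (𝓝 (p i)) := by
      simpa using (hshift 0).continuousAt.tendsto
    refine ⟨fun s => g (p i + s), (ht.eventually hg).mono fun s hs => ?_, by simp, ?_⟩
    · simpa [Function.comp_def] using hs.comp s (hshift s)
    · have : HasDerivAt g b'' (p i + 0) := by simpa using hg'
      simpa [Function.comp_def] using this.comp 0 (hshift 0)
  · simpa [hi, Ne.symm hi] using HasDeriv2At.const (b (p N))

/-- The power 1 - a has constant flux, hence contributes nothing to the operator; it dominates the
o(t^(1-a)) errors at the flat boundary. The square supplies the strict sign in the interior. -/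
theorem barrier (ha : p N > 0) : HasWeightedLaplacian a N
    (fun y => y N ^ (1 - a) + y N ^ (2 : ℝ)) (2 * (1 + a) * p N) p := by
  have hid : HasDeriv2At (fun s : ℝ => s) 1 0 (p N) := by
    simpa using HasDeriv2At.affine (0 : ℝ) 1 (x := p N)
  have := of_height (a := a) ((hid.rpow_const ha (1 - a)).add (hid.rpow_const ha 2))
  convert this using 1
  have h1 : p N ^ (1 - a - 1) = p N * p N ^ (1 - a - 2) := by
    rw [mul_comm, ← Real.rpow_add_one ha.ne']; ring_nf
  rw [h1]; norm_num; ring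

end HasWeightedLaplacian

/-- The non-divergence form of `div (x_N ^ a ∇u) = 0`. -/
theorem nondivergence_form {n : ℕ} {a : ℝ} {N : Fin n} {u : EuclideanSpace ℝ (Fin n) → ℝ}
    {x : EuclideanSpace ℝ (Fin n)} (hx : 0 < x N) (hu : ContDiffAt ℝ 2 u x)
    (heq : divergence (fun y => (y N) ^ a • gradient u y) x = 0) :
    x N * ∑ i, fderiv ℝ (fderiv ℝ u) x (EuclideanSpace.single i 1) (EuclideanSpace.single i 1) +
      a * fderiv ℝ u x (EuclideanSpace.single N 1) = 0 := by
  have hd : DifferentiableAt ℝ (fderiv ℝ u) x :=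
    (hu.fderiv_right (m := 1) (by norm_num)).differentiableAt (by simp)
  have hgrad (y : EuclideanSpace ℝ (Fin n)) (i : Fin n) :
      gradient u y i = fderiv ℝ u y (EuclideanSpace.single i 1) := by
    rw [← inner_gradient_left, EuclideanSpace.inner_single_right]; simp
  have hpart (i : Fin n) : partialDeriv i (fun y => ((y N) ^ a • gradient u y) i) x =
      x N ^ a * fderiv ℝ (fderiv ℝ u) x (EuclideanSpace.single i 1) (EuclideanSpace.single i 1) +
      (if N = i then a * x N ^ (a - 1) * fderiv ℝ u x (EuclideanSpace.single i 1) else 0) := by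
    have h1 : HasFDerivAt (fun y : EuclideanSpace ℝ (Fin n) => y N)
        (EuclideanSpace.proj N : EuclideanSpace ℝ (Fin n) →L[ℝ] ℝ) x :=
      (EuclideanSpace.proj N : EuclideanSpace ℝ (Fin n) →L[ℝ] ℝ).hasFDerivAt
    have h2 := (h1.rpow_const (p := a) (Or.inl hx.ne')).mul
      (hd.hasFDerivAt.clm_apply (hasFDerivAt_const (EuclideanSpace.single i (1 : ℝ)) x))
    have h3 : (fun y => ((y N) ^ a • gradient u y) i) =
        fun y => (y N) ^ a * fderiv ℝ u y (EuclideanSpace.single i 1) := by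
      funext y; simp [hgrad]
    rw [partialDeriv, h3]
    erw [h2.fderiv]
    by_cases hi : N = i <;> simp [hi] 
    ring
  simp only [divergence, hpart, Finset.sum_add_distrib, ← Finset.mul_sum, Finset.sum_ite_eq,
    Finset.mem_univ, if_true] at heq
  have h4 : x N ^ a = x N ^ (a - 1) * x N := by
    rw [← Real.rpow_add_one hx.ne']; ring_nf
  have h5 := Real.rpow_pos_of_pos hx (a - 1)
  rw [h4] at heq
  refine (mul_eq_zero.1 (?_ : x N ^ (a - 1) * _ = 0)).resolve_left h5.ne'
  linear_combination heq

theorem HasWeightedLaplacian.of_contDiffAt {n : ℕ} {a : ℝ} {N : Fin n}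
    {u : EuclideanSpace ℝ (Fin n) → ℝ} {x : EuclideanSpace ℝ (Fin n)} (hu : ContDiffAt ℝ 2 u x) :
    HasWeightedLaplacian a N u (x N * ∑ i, fderiv ℝ (fderiv ℝ u) x (EuclideanSpace.single i 1)
      (EuclideanSpace.single i 1) + a * fderiv ℝ u x (EuclideanSpace.single N 1)) x := by
  refine ⟨fun i => fderiv ℝ u x (EuclideanSpace.single i 1),
    fun i => fderiv ℝ (fderiv ℝ u) x (EuclideanSpace.single i 1) (EuclideanSpace.single i 1),
    fun i => ?_, rfl⟩
  have h := HasDeriv2At.comp (u := u) (by simpa using hu)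
    (HasDeriv2At.affine x (EuclideanSpace.single i (1 : ℝ)) (x := 0))
  exact h.congr_deriv (by simp) (by simp)

/-! ### The Kelvin transform and the invariance of the equation. -/

/-- The Kelvin transform `|y - x₀| ^ (-k) u (x₀ + μ (y - x₀) / |y - x₀| ^ 2)`. -/
def kelvin {n : ℕ} (k μ : ℝ) (x₀ : EuclideanSpace ℝ (Fin n)) (u : EuclideanSpace ℝ (Fin n) → ℝ)
    (y : EuclideanSpace ℝ (Fin n)) : ℝ :=
  (‖y - x₀‖ ^ 2) ^ (-k / 2) * u (x₀ + (μ / ‖y - x₀‖ ^ 2) • (y - x₀))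

variable {n : ℕ}

/-- Along a coordinate line the squared distance to the centre is a quadratic polynomial, with
derivatives 2 q_i and 2 at 0; the rest is the product and chain rules. Writing r for the inverse
square keeps everything but one common power polynomial. -/
theorem hasDeriv2At_kelvin {k μ : ℝ} {x₀ p q ξ : EuclideanSpace ℝ (Fin n)}
    {u : EuclideanSpace ℝ (Fin n) → ℝ} (hq : p - x₀ = q) (hq0 : q ≠ 0)
    (hξ : x₀ + (μ / ‖q‖ ^ 2) • q = ξ) (hu : ContDiffAt ℝ 2 u ξ)
    {r : ℝ} (hr : r = (‖q‖ ^ 2)⁻¹) (i : Fin n) :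
    HasDeriv2At (fun s : ℝ => kelvin k μ x₀ u (p + s • EuclideanSpace.single i (1 : ℝ)))
      ((‖q‖ ^ 2) ^ (-k / 2) * (-k * r * q i * u ξ + μ * (-2 * q i * r ^ 2 * fderiv ℝ u ξ q +
        r * fderiv ℝ u ξ (EuclideanSpace.single i 1))))
      ((‖q‖ ^ 2) ^ (-k / 2) * ((-k * r + k * (k + 2) * r ^ 2 * q i ^ 2) * u ξ
        + 2 * (-k * r * q i) * (μ * (-2 * q i * r ^ 2 * fderiv ℝ u ξ q +
          r * fderiv ℝ u ξ (EuclideanSpace.single i 1)))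
        + μ ^ 2 * (r ^ 2 * fderiv ℝ (fderiv ℝ u) ξ (EuclideanSpace.single i 1)
            (EuclideanSpace.single i 1)
          - 2 * q i * r ^ 3 * (fderiv ℝ (fderiv ℝ u) ξ (EuclideanSpace.single i 1) q
            + fderiv ℝ (fderiv ℝ u) ξ q (EuclideanSpace.single i 1))
          + 4 * q i ^ 2 * r ^ 4 * fderiv ℝ (fderiv ℝ u) ξ q q)
        + μ * ((8 * q i ^ 2 * r ^ 3 - 2 * r ^ 2) * fderiv ℝ u ξ q
          - 4 * q i * r ^ 2 * fderiv ℝ u ξ (EuclideanSpace.single i 1)))) 0 := by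
  set e : EuclideanSpace ℝ (Fin n) := EuclideanSpace.single i 1 with he
  have hR : 0 < ‖q‖ ^ 2 := by positivity
  have hsq (s : ℝ) : ‖q + s • e‖ ^ 2 = (‖q‖ ^ 2 + s • (2 * q i)) + s • s := by
    rw [norm_add_sq_real, inner_smul_right, he, EuclideanSpace.inner_single_right, norm_smul]
    simp
    ring
  have hid : HasDeriv2At (fun s : ℝ => s) 1 0 0 := by
    simpa using HasDeriv2At.affine (0 : ℝ) 1 (x := 0)
  have hρ : HasDeriv2At (fun s : ℝ => ‖q + s • e‖ ^ 2) (2 * q i) 2 0 := by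
    simp_rw [hsq]
    exact ((HasDeriv2At.affine (‖q‖ ^ 2) (2 * q i)).add (hid.smul hid)).congr_deriv
      (by simp) (by simp)
  have hρ0 : 0 < ‖q + (0 : ℝ) • e‖ ^ 2 := by simpa using hR
  have hc := (HasDeriv2At.const x₀).add
    (((hρ.rpow_const hρ0 (-1)).smul (HasDeriv2At.affine q e)).const_smul μ)
  have hξ' : x₀ + μ • ((‖q + (0 : ℝ) • e‖ ^ 2) ^ (-1 : ℝ) • (q + (0 : ℝ) • e)) = ξ := by
    rw [← hξ, smul_smul, div_eq_mul_inv, Real.rpow_neg_one]; simp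
  have hK := (hρ.rpow_const hρ0 (-k / 2)).smul (hc.comp (u := u) (by rw [hξ']; exact hu))
  have hfun : (fun s : ℝ => kelvin k μ x₀ u (p + s • e)) = fun s : ℝ =>
      (‖q + s • e‖ ^ 2) ^ (-k / 2) • u (x₀ + μ • ((‖q + s • e‖ ^ 2) ^ (-1 : ℝ) • (q + s • e))) := by
    funext s
    rw [kelvin, show p + s • e - x₀ = q + s • e by rw [← hq]; abel, smul_smul,
      div_eq_mul_inv μ, Real.rpow_neg_one, smul_eq_mul]
  rw [hfun]
  have p1 : (‖q‖ ^ 2) ^ (-1 : ℝ) = r := by rw [Real.rpow_neg_one, hr]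
  have p2 : (‖q‖ ^ 2) ^ (-1 - 1 : ℝ) = r ^ 2 := by
    rw [Real.rpow_sub_one hR.ne', p1, hr]; field_simp
  have p3 : (‖q‖ ^ 2) ^ (-1 - 2 : ℝ) = r ^ 3 := by
    rw [show (-1 - 2 : ℝ) = -1 - 1 - 1 by norm_num, Real.rpow_sub_one hR.ne', p2, hr]; field_simp
  have p4 : (‖q‖ ^ 2) ^ (-k / 2 - 1) = (‖q‖ ^ 2) ^ (-k / 2) * r := by
    rw [Real.rpow_sub_one hR.ne', hr]; rfl
  have p5 : (‖q‖ ^ 2) ^ (-k / 2 - 2) = (‖q‖ ^ 2) ^ (-k / 2) * r ^ 2 := by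
    rw [show -k / 2 - 2 = -k / 2 - 1 - 1 by ring, Real.rpow_sub_one hR.ne', p4, hr]; field_simp
  refine hK.congr_deriv ?_ ?_
  · rw [hξ']
    simp only [zero_smul, add_zero, smul_eq_mul, p1, p2, p4, zero_add, map_add, map_smul]
    ring
  · rw [hξ']
    simp only [zero_smul, add_zero, smul_eq_mul, p1, p2, p3, p4, p5, zero_add, map_add, map_smul,
      add_apply, smul_apply, smul_zero]
    ring

theorem sum_mul_apply_single (L : EuclideanSpace ℝ (Fin n) →L[ℝ] ℝ)
    (q : EuclideanSpace ℝ (Fin n)) : ∑ i, q i * L (EuclideanSpace.single i 1) = L q := by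
  conv_rhs => rw [← (EuclideanSpace.basisFun (Fin n) ℝ).sum_repr q]
  simp

/-- After summation over i, the terms in H q q cancel because r |q|^2 = 1. Those in u and in D q
cancel against a ∂_N exactly when k = n - 2 + a. What remains is a multiple of the equation at the
inverted point ξ, whose height is μ r q_N. -/
theorem HasWeightedLaplacian.kelvin {a k μ : ℝ} {N : Fin n} {x₀ p ξ : EuclideanSpace ℝ (Fin n)}
    {u : EuclideanSpace ℝ (Fin n) → ℝ} (hk : k = n - 2 + a) (hx₀ : x₀ N = 0)
    (hp : 0 < p N) (hξ : x₀ + (μ / ‖p - x₀‖ ^ 2) • (p - x₀) = ξ) (hu : ContDiffAt ℝ 2 u ξ)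
    (heq : ξ N * ∑ i, fderiv ℝ (fderiv ℝ u) ξ (EuclideanSpace.single i 1)
      (EuclideanSpace.single i 1) + a * fderiv ℝ u ξ (EuclideanSpace.single N 1) = 0) :
    HasWeightedLaplacian a N (kelvin k μ x₀ u) 0 p := by
  obtain ⟨q, hq⟩ : ∃ q, p - x₀ = q := ⟨_, rfl⟩
  have hqN : q N = p N := by rw [← hq]; simp [hx₀]
  have hq0 : q ≠ 0 := by rintro rfl; simp at hqN; exact hp.ne hqN
  rw [hq] at hξ
  have hR : 0 < ‖q‖ ^ 2 := by positivity
  obtain ⟨r, hr⟩ : ∃ r, r = (‖q‖ ^ 2)⁻¹ := ⟨_, rfl⟩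
  refine ⟨_, _, fun i => hasDeriv2At_kelvin hq hq0 hξ hu hr i, ?_⟩
  have hξN : ξ N = μ * r * q N := by rw [← hξ, hr]; simp [hx₀, div_eq_mul_inv]
  have hrR : r * ∑ i, q i ^ 2 = 1 := by
    have : ∑ i, q i ^ 2 = ‖q‖ ^ 2 := by rw [EuclideanSpace.norm_sq_eq]; simp
    rw [this, hr]; field_simp
  set D := fderiv ℝ u ξ
  set H := fderiv ℝ (fderiv ℝ u) ξ
  have s1 := sum_mul_apply_single D q
  have s2 := sum_mul_apply_single (H.flip q) q
  have s3 := sum_mul_apply_single (H q) q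
  simp only [ContinuousLinearMap.flip_apply] at s2
  rw [← Finset.mul_sum]
  have hsum : ∑ i, ((-k * r + k * (k + 2) * r ^ 2 * q i ^ 2) * u ξ
        + 2 * (-k * r * q i) * (μ * (-2 * q i * r ^ 2 * D q + r * D (EuclideanSpace.single i 1)))
        + μ ^ 2 * (r ^ 2 * H (EuclideanSpace.single i 1) (EuclideanSpace.single i 1)
          - 2 * q i * r ^ 3 * (H (EuclideanSpace.single i 1) q + H q (EuclideanSpace.single i 1))
          + 4 * q i ^ 2 * r ^ 4 * H q q)
        + μ * ((8 * q i ^ 2 * r ^ 3 - 2 * r ^ 2) * D q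
          - 4 * q i * r ^ 2 * D (EuclideanSpace.single i 1))) =
      n * (-k * r * u ξ - 2 * μ * r ^ 2 * D q)
      + (∑ i, q i ^ 2) * (k * (k + 2) * r ^ 2 * u ξ + 4 * k * μ * r ^ 3 * D q
        + 4 * μ ^ 2 * r ^ 4 * H q q + 8 * μ * r ^ 3 * D q)
      + D q * (-2 * k * μ * r ^ 2 - 4 * μ * r ^ 2)
      + μ ^ 2 * r ^ 2 * ∑ i, H (EuclideanSpace.single i 1) (EuclideanSpace.single i 1)
      - 4 * μ ^ 2 * r ^ 3 * H q q := by
    have h0 : (n : ℝ) * (-k * r * u ξ - 2 * μ * r ^ 2 * D q) =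
      ∑ _i : Fin n, (-k * r * u ξ - 2 * μ * r ^ 2 * D q) := by
      rw [Finset.sum_const, Finset.card_univ, Fintype.card_fin, nsmul_eq_mul]
    have h1 : D q * (-2 * k * μ * r ^ 2 - 4 * μ * r ^ 2) =
      (∑ i, q i * D (EuclideanSpace.single i 1)) * (-2 * k * μ * r ^ 2 - 4 * μ * r ^ 2) := by
      rw [s1]
    have h2 : 4 * μ ^ 2 * r ^ 3 * H q q =
      2 * μ ^ 2 * r ^ 3 * (∑ i, q i * H (EuclideanSpace.single i 1) q) +
      2 * μ ^ 2 * r ^ 3 * (∑ i, q i * H q (EuclideanSpace.single i 1)) := by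
      rw [s2, s3]; ring
    rw [h0, h1, h2, Finset.sum_mul, Finset.sum_mul, Finset.mul_sum, Finset.mul_sum,
      Finset.mul_sum, ← Finset.sum_add_distrib, ← Finset.sum_add_distrib, ← Finset.sum_add_distrib,
      ← Finset.sum_add_distrib, ← Finset.sum_sub_distrib]
    exact Finset.sum_congr rfl fun i _ => by ring
  rw [hsum, ← hqN]
  rw [hξN] at heq
  set S := ∑ i, q i ^ 2
  set T := ∑ i, H (EuclideanSpace.single i 1) (EuclideanSpace.single i 1)
  have hn : (n : ℝ) = k + 2 - a := by rw [hk]; ring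
  rw [hn]
  linear_combination (‖q‖ ^ 2) ^ (-k / 2) * (μ * r * heq + q N * (k * (k + 2) * r * u ξ
    + 4 * k * μ * r ^ 2 * D q + 4 * μ ^ 2 * r ^ 3 * H q q + 8 * μ * r ^ 2 * D q) * hrR)

/-! ### The Neumann condition in integrated form. -/

open Asymptotics

/-- The integrated form of the weighted Neumann condition. -/
theorem vertical_isLittleO {n : ℕ} {a : ℝ} (ha : a < 1) {N : Fin n}
    {u : EuclideanSpace ℝ (Fin n) → ℝ} (hd : ∀ x, 0 < x N → DifferentiableAt ℝ u x)
    (hc : ContinuousOn u {x | 0 ≤ x N}) {x : EuclideanSpace ℝ (Fin n)} (hx : x N = 0)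
    (hbdry : Tendsto (fun t : ℝ => t ^ a * partialDeriv N u
      (x + t • EuclideanSpace.single N (1 : ℝ))) (𝓝[>] 0) (𝓝 0)) :
    (fun t : ℝ => u (x + t • EuclideanSpace.single N (1 : ℝ)) - u x) =o[𝓝[>] 0]
      fun t => t ^ (1 - a) := by
  set e : EuclideanSpace ℝ (Fin n) := EuclideanSpace.single N 1 with he
  have hN (t : ℝ) : (x + t • e) N = t := by simp [he, hx]
  have hder (t : ℝ) (ht : 0 < t) :
      HasDerivAt (fun t : ℝ => u (x + t • e)) (partialDeriv N u (x + t • e)) t := by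
    have h1 : HasDerivAt (fun t : ℝ => x + t • e) e t := by
      simpa using ((hasDerivAt_id t).smul_const e).const_add x
    exact (hd _ (by rwa [hN])).hasFDerivAt.comp_hasDerivAt t h1
  have hcont : ContinuousOn (fun t : ℝ => u (x + t • e)) (Set.Ici 0) :=
    hc.comp (by fun_prop) fun t ht => by simpa [hN] using ht
  rw [isLittleO_iff]
  intro c hc0
  -- The bound c (1 - a) is chosen so that |∂_N u| is at most the derivative of c t^(1-a); adding or
  -- subtracting that power makes u monotone in t.
  have hev : ∀ᶠ t in 𝓝[>] (0 : ℝ), |t ^ a * partialDeriv N u (x + t • e)| < c * (1 - a) := by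
    have := hbdry.abs
    rw [abs_zero] at this
    exact this.eventually (gt_mem_nhds (by nlinarith))
  obtain ⟨δ, hδ, hδ'⟩ := mem_nhdsGT_iff_exists_Ioo_subset.1 hev
  have hpow (t : ℝ) (ht : 0 < t) :
      HasDerivAt (fun t : ℝ => c * t ^ (1 - a)) (c * (1 - a) * t ^ (-a)) t := by
    refine ((Real.hasDerivAt_rpow_const (p := 1 - a) (Or.inl ht.ne')).const_mul c).congr_deriv ?_
    rw [show 1 - a - 1 = -a by ring]; ring
  have hpcont : Continuous fun t : ℝ => c * t ^ (1 - a) :=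
    continuous_const.mul (Real.continuous_rpow_const (by linarith))
  have hbound (t : ℝ) (ht : t ∈ Set.Ioo 0 δ) :
      |partialDeriv N u (x + t • e)| ≤ c * (1 - a) * t ^ (-a) := by
    have h1 : |t ^ a * partialDeriv N u (x + t • e)| < c * (1 - a) := hδ' ht
    have h2 := Real.rpow_pos_of_pos ht.1 a
    rw [abs_mul, abs_of_pos h2] at h1
    rw [Real.rpow_neg ht.1.le, ← div_eq_mul_inv, le_div_iff₀ h2]
    linarith
  have hsub : Set.Ico 0 δ ⊆ Set.Ici (0 : ℝ) := fun t ht => ht.1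
  have hmono : MonotoneOn (fun t : ℝ => u (x + t • e) + c * t ^ (1 - a)) (Set.Ico 0 δ) := by
    refine monotoneOn_of_hasDerivWithinAt_nonneg (convex_Ico 0 δ)
      ((hcont.mono hsub).add hpcont.continuousOn) (f' := fun t => partialDeriv N u (x + t • e) +
        c * (1 - a) * t ^ (-a)) ?_ ?_ <;> intro t ht <;> rw [interior_Ico] at ht
    · exact ((hder t ht.1).add (hpow t ht.1)).hasDerivWithinAt
    · linarith [neg_abs_le (partialDeriv N u (x + t • e)), hbound t ht]
  have hanti : AntitoneOn (fun t : ℝ => u (x + t • e) - c * t ^ (1 - a)) (Set.Ico 0 δ) := by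
    refine antitoneOn_of_hasDerivWithinAt_nonpos (convex_Ico 0 δ)
      ((hcont.mono hsub).sub hpcont.continuousOn) (f' := fun t => partialDeriv N u (x + t • e) -
        c * (1 - a) * t ^ (-a)) ?_ ?_ <;> intro t ht <;> rw [interior_Ico] at ht
    · exact ((hder t ht.1).sub (hpow t ht.1)).hasDerivWithinAt
    · linarith [le_abs_self (partialDeriv N u (x + t • e)), hbound t ht]
  filter_upwards [Ioo_mem_nhdsGT hδ] with t ht
  have h0 : (0 : ℝ) ∈ Set.Ico 0 δ := ⟨le_rfl, hδ⟩
  have ht' : t ∈ Set.Ico 0 δ := ⟨ht.1.le, ht.2⟩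
  have h1 := hmono h0 ht' ht.1.le
  have h2 := hanti h0 ht' ht.1.le
  simp only [zero_smul, add_zero, Real.zero_rpow (by linarith : 1 - a ≠ 0), mul_zero, sub_zero]
    at h1 h2
  rw [Real.norm_eq_abs, Real.norm_of_nonneg (Real.rpow_nonneg ht.1.le _), abs_le]
  constructor <;> linarith

/-- The Kelvin transform inherits the integrated weighted Neumann condition. -/
theorem kelvin_vertical_isLittleO {n : ℕ} {a k μ : ℝ} (ha : -1 < a) (ha' : a < 1) (hμ : 0 < μ)
    {N : Fin n} {u : EuclideanSpace ℝ (Fin n) → ℝ}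
    (hlip : LocallyLipschitzOn {x | 0 ≤ x N} u)
    (hbd : ∀ x : EuclideanSpace ℝ (Fin n), x N = 0 →
      (fun t : ℝ => u (x + t • EuclideanSpace.single N (1 : ℝ)) - u x) =o[𝓝[>] 0]
        fun t => t ^ (1 - a))
    {x₀ y : EuclideanSpace ℝ (Fin n)} (hx₀ : x₀ N = 0) (hy : y N = 0) (hne : y ≠ x₀) :
    (fun t : ℝ => kelvin k μ x₀ u (y + t • EuclideanSpace.single N (1 : ℝ)) - kelvin k μ x₀ u y)
      =o[𝓝[>] 0] fun t => t ^ (1 - a) := by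
  set e : EuclideanSpace ℝ (Fin n) := EuclideanSpace.single N 1 with he
  obtain ⟨q, hq⟩ : ∃ q, y - x₀ = q := ⟨_, rfl⟩
  have hqN : q N = 0 := by rw [← hq]; simp [hx₀, hy]
  have hq0 : q ≠ 0 := hq ▸ sub_ne_zero.2 hne
  have heN : e N = 1 := by simp [he]
  set ρ := ‖q‖ ^ 2 with hρ
  have hρ0 : 0 < ρ := by positivity
  have hsq (t : ℝ) : ‖q + t • e‖ ^ 2 = ρ + t ^ 2 := by
    rw [norm_add_sq_real, inner_smul_right, he, EuclideanSpace.inner_single_right, norm_smul]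
    simp [hqN, hρ]
  have ht0 : Tendsto (fun t : ℝ => t) (𝓝[>] 0) (𝓝 0) := nhdsWithin_le_nhds
  -- Quadratic errors are negligible because 2 > 1 - a, that is, a > -1.
  have hsqo : (fun t : ℝ => t ^ 2) =o[𝓝[>] 0] fun t => t ^ (1 - a) := by
    have h1 : (fun t : ℝ => t ^ (1 + a)) =o[𝓝[>] 0] fun _ => (1 : ℝ) := by
      rw [isLittleO_one_iff]
      have := (Real.continuous_rpow_const (by linarith : 0 ≤ 1 + a)).tendsto 0
      rw [Real.zero_rpow (by linarith)] at this
      exact this.comp ht0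
    refine (h1.mul_isBigO (isBigO_refl (fun t : ℝ => t ^ (1 - a)) _)).congr' ?_ ?_
    · filter_upwards [self_mem_nhdsWithin] with t ht
      rw [← Real.rpow_add ht, show 1 + a + (1 - a) = (2 : ℕ) by push_cast; ring, Real.rpow_natCast]
    · exact .of_forall fun t => by simp
  have hpert {g : ℝ → ℝ} (hg : DifferentiableAt ℝ g ρ) :
      (fun t : ℝ => g (ρ + t ^ 2) - g ρ) =O[𝓝[>] 0] fun t => t ^ 2 := by
    have hT : Tendsto (fun t : ℝ => ρ + t ^ 2) (𝓝[>] 0) (𝓝 ρ) := by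
      have : Continuous fun t : ℝ => ρ + t ^ 2 := by fun_prop
      have := this.tendsto 0
      simp only [ne_eq, OfNat.ofNat_ne_zero, not_false_eq_true, zero_pow, add_zero] at this
      exact this.comp ht0
    simpa [Function.comp_def] using hg.isBigO_sub.comp_tendsto hT
  have hinv := hpert (g := fun s => μ / s) (by fun_prop (disch := exact hρ0.ne'))
  have hphi := hpert (g := fun s => s ^ (-k / 2))
    (Real.differentiableAt_rpow_const_of_ne _ hρ0.ne')
  set y₁ := x₀ + (μ / ρ) • q with hy₁
  have hy₁N : y₁ N = 0 := by simp [hy₁, hx₀, hqN]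
  -- The height of the inverted point z(t). That point differs from y₁ + τ(t) e only by a horizontal
  -- vector of size O(t^2), which the Lipschitz bound absorbs; the vertical part is the hypothesis
  -- at y₁.
  set τ : ℝ → ℝ := fun t => μ / (ρ + t ^ 2) * t with hτ
  have hτpos : ∀ t > 0, 0 < τ t := fun t ht => by simp only [hτ]; positivity
  have hτ0 : Tendsto τ (𝓝[>] 0) (𝓝 0) := by
    have : Continuous τ := by
      simp only [hτ]
      exact (continuous_const.div (by fun_prop) fun t => by positivity).mul continuous_id
    have := this.tendsto 0
    simp only [hτ, mul_zero] at this
    exact this.comp ht0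
  have hτ0' : Tendsto τ (𝓝[>] 0) (𝓝[>] 0) :=
    tendsto_nhdsWithin_iff.2 ⟨hτ0, eventually_mem_nhdsWithin.mono hτpos⟩
  have hτO : (fun t => τ t ^ (1 - a)) =O[𝓝[>] 0] fun t => t ^ (1 - a) := by
    refine IsBigO.of_bound ((μ / ρ) ^ (1 - a)) ?_
    filter_upwards [self_mem_nhdsWithin] with t (ht : 0 < t)
    rw [Real.norm_of_nonneg (Real.rpow_nonneg (hτpos t ht).le _),
      Real.norm_of_nonneg (Real.rpow_nonneg ht.le _), ← Real.mul_rpow (by positivity) ht.le]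
    refine Real.rpow_le_rpow (hτpos t ht).le ?_ (by linarith)
    simp only [hτ]
    gcongr
    nlinarith [sq_nonneg t]
  have hvert := ((hbd y₁ hy₁N).comp_tendsto hτ0').trans_isBigO hτO
  set z : ℝ → EuclideanSpace ℝ (Fin n) := fun t => x₀ + (μ / (ρ + t ^ 2)) • (q + t • e) with hz
  have hzc : Tendsto z (𝓝[>] 0) (𝓝 y₁) := by
    have : Continuous z := by
      simp only [hz]
      have hcoef : Continuous fun t : ℝ => μ / (ρ + t ^ 2) :=
        continuous_const.div (by fun_prop) fun t => by positivity
      fun_prop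
    have := this.tendsto 0
    simp only [hz, zero_smul, add_zero, ne_eq, OfNat.ofNat_ne_zero, not_false_eq_true,
      zero_pow] at this
    exact this.comp ht0
  have hzc' : Tendsto (fun t => y₁ + τ t • e) (𝓝[>] 0) (𝓝 y₁) := by
    simpa using (hτ0.smul_const e).const_add y₁
  have hhor : (fun t => u (z t) - u (y₁ + τ t • e)) =O[𝓝[>] 0] fun t => t ^ 2 := by
    obtain ⟨K, s, hs, hK⟩ := hlip (show y₁ ∈ {x | 0 ≤ x N} from hy₁N.ge)
    have m1 : ∀ᶠ t in 𝓝[>] (0 : ℝ), z t ∈ s := by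
      refine (tendsto_nhdsWithin_iff.2 ⟨hzc, ?_⟩ : Tendsto z _ (𝓝[{x | 0 ≤ x N}] y₁)).eventually hs
      filter_upwards [self_mem_nhdsWithin] with t (ht : 0 < t)
      simp only [hz, PiLp.add_apply, PiLp.smul_apply, hx₀, hqN, heN, smul_eq_mul]
      positivity
    have m2 : ∀ᶠ t in 𝓝[>] (0 : ℝ), y₁ + τ t • e ∈ s := by
      refine (tendsto_nhdsWithin_iff.2 ⟨hzc', ?_⟩ :
        Tendsto _ _ (𝓝[{x | 0 ≤ x N}] y₁)).eventually hs
      filter_upwards [self_mem_nhdsWithin] with t (ht : 0 < t)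
      simpa [hy₁N, heN] using (hτpos t ht).le
    have hO : (fun t => u (z t) - u (y₁ + τ t • e)) =O[𝓝[>] 0]
        fun t => z t - (y₁ + τ t • e) := by
      refine IsBigO.of_bound K ?_
      filter_upwards [m1, m2] with t h1 h2
      simpa [dist_eq_norm] using hK.dist_le_mul _ h1 _ h2
    refine hO.trans ?_
    have : (fun t => z t - (y₁ + τ t • e)) = fun t : ℝ => (μ / (ρ + t ^ 2) - μ / ρ) • q := by
      funext t
      simp only [hz, hy₁, hτ, smul_add, sub_smul, smul_smul]
      abel
    rw [this]
    simpa using hinv.smul (isBigO_refl (fun _ => q) (𝓝[>] (0 : ℝ))) |>.trans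
      ((isBigO_refl (fun t : ℝ => t ^ 2) _).smul (isBigO_const_const q (one_ne_zero (α := ℝ)) _))
  have hu : (fun t => u (z t) - u y₁) =o[𝓝[>] 0] fun t => t ^ (1 - a) :=
    ((hhor.trans_isLittleO hsqo).add hvert).congr (fun t => by simp) fun t => rfl
  have hbdd : (fun t : ℝ => (ρ + t ^ 2) ^ (-k / 2)) =O[𝓝[>] 0] fun _ => (1 : ℝ) := by
    have hT : Tendsto (fun t : ℝ => (ρ + t ^ 2) ^ (-k / 2)) (𝓝 0)
        (𝓝 ((ρ + 0 ^ 2) ^ (-k / 2))) :=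
      (Continuous.rpow_const (by fun_prop) fun t =>
        Or.inl (by positivity : ρ + t ^ 2 ≠ 0)).tendsto 0
    exact (hT.comp ht0).isBigO_one ℝ
  have hfin := (hbdd.mul_isLittleO hu).add
    (((hphi.trans_isLittleO hsqo).mul_isBigO (isBigO_refl (fun _ => u y₁) _)).trans_isBigO
      ((isBigO_refl (fun t : ℝ => t ^ (1 - a)) _).mul
        (isBigO_const_const (u y₁) (one_ne_zero (α := ℝ)) _)) |>.congr_right fun t => by
          rw [mul_one, one_mul])
  refine hfin.congr (fun t => ?_) fun t => one_mul _
  rw [kelvin, kelvin, show y + t • e - x₀ = q + t • e by rw [← hq]; abel, hq, hsq, ← hρ]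
  simp only [hz, ← hy₁]
  ring

/-! ### Comparison with Kelvin transforms. -/

/-- A positive solution dominates its Kelvin transforms centred on the boundary, outside the
sphere of inversion. -/
theorem kelvin_le {n : ℕ} {a k μ : ℝ} (ha : -1 < a) (ha' : a < 1) (hk : k = n - 2 + a)
    (hk0 : 0 < k) (hμ : 0 < μ) {N : Fin n} {u : EuclideanSpace ℝ (Fin n) → ℝ}
    (hu2 : ∀ x, 0 < x N → ContDiffAt ℝ 2 u x) (hlip : LocallyLipschitzOn {x | 0 ≤ x N} u)
    (hnonneg : ∀ x, 0 ≤ x N → 0 ≤ u x)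
    (heq : ∀ x, 0 < x N → x N * ∑ i, fderiv ℝ (fderiv ℝ u) x (EuclideanSpace.single i 1)
      (EuclideanSpace.single i 1) + a * fderiv ℝ u x (EuclideanSpace.single N 1) = 0)
    (hbd : ∀ x : EuclideanSpace ℝ (Fin n), x N = 0 →
      (fun t : ℝ => u (x + t • EuclideanSpace.single N (1 : ℝ)) - u x) =o[𝓝[>] 0]
        fun t => t ^ (1 - a))
    {x₀ : EuclideanSpace ℝ (Fin n)} (hx₀ : x₀ N = 0) {y : EuclideanSpace ℝ (Fin n)}
    (hy : 0 ≤ y N) (hyμ : μ ≤ ‖y - x₀‖ ^ 2) :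
    μ ^ (k / 2) * kelvin k μ x₀ u y ≤ u y := by
  by_contra! hlt
  have hcont : ContinuousOn u {x | 0 ≤ x N} := hlip.continuousOn
  set M := μ ^ (k / 2) with hM
  have hM0 : 0 < M := Real.rpow_pos_of_pos hμ _
  have hcN : Continuous fun z : EuclideanSpace ℝ (Fin n) => z N := by fun_prop
  have hinvN {z : EuclideanSpace ℝ (Fin n)} (hz : 0 ≤ z N) :
      0 ≤ (x₀ + (μ / ‖z - x₀‖ ^ 2) • (z - x₀)) N := by
    simp only [PiLp.add_apply, PiLp.smul_apply, PiLp.sub_apply, hx₀, smul_eq_mul]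
    have : 0 ≤ μ / ‖z - x₀‖ ^ 2 := by positivity
    nlinarith [mul_nonneg this hz]
  obtain ⟨η, hη, hyη⟩ : ∃ η > 0, u y - M * kelvin k μ x₀ u y = -(2 * η) :=
    ⟨(M * kelvin k μ x₀ u y - u y) / 2, by linarith, by ring⟩
  -- the Kelvin transform is small on large spheres
  obtain ⟨δ, hδ, hδB⟩ : ∃ δ > 0, ∀ z : EuclideanSpace ℝ (Fin n), 0 ≤ z N → ‖z - x₀‖ < δ →
      u z ≤ u x₀ + 1 := by
    have h1 := (hcont x₀ hx₀.ge).eventually (gt_mem_nhds (lt_add_one (u x₀)))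
    obtain ⟨δ, hδ, h2⟩ := Metric.mem_nhdsWithin_iff.1 h1
    exact ⟨δ, hδ, fun z hz hzδ => (h2 ⟨by simpa [dist_eq_norm] using hzδ, hz⟩).le⟩
  have hdecay : Tendsto (fun R : ℝ => M * ((R ^ 2) ^ (-k / 2) * (u x₀ + 1))) atTop (𝓝 0) := by
    have h1 : Tendsto (fun R : ℝ => (R ^ 2) ^ (-(k / 2))) atTop (𝓝 0) :=
      (tendsto_rpow_neg_atTop (by positivity)).comp (tendsto_pow_atTop two_ne_zero)
    simpa [neg_div] using (h1.mul_const (u x₀ + 1)).const_mul M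
  -- Inversion sends the sphere of radius R to the one of radius μ / R < δ, where u is at most u(x₀)
  -- + 1; `hR1` then makes the transform smaller than η there.
  obtain ⟨R, hR1, hR2, hR3⟩ := ((hdecay.eventually (gt_mem_nhds hη)).and
    ((eventually_gt_atTop ‖y - x₀‖).and (eventually_gt_atTop (μ / δ)))).exists
  have hR0 : 0 < R := (norm_nonneg _).trans_lt hR2
  have hfar {z : EuclideanSpace ℝ (Fin n)} (hz : 0 ≤ z N) (hzR : ‖z - x₀‖ = R) :
      -η ≤ u z - M * kelvin k μ x₀ u z := by
    have h1 : u (x₀ + (μ / ‖z - x₀‖ ^ 2) • (z - x₀)) ≤ u x₀ + 1 := by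
      refine hδB _ (hinvN hz) ?_
      rw [add_sub_cancel_left, norm_smul, hzR, Real.norm_of_nonneg (by positivity)]
      rw [show μ / R ^ 2 * R = μ / R by field_simp]
      exact (div_lt_comm₀ hδ hR0).1 hR3
    have h2 : M * kelvin k μ x₀ u z ≤ M * ((R ^ 2) ^ (-k / 2) * (u x₀ + 1)) := by
      rw [kelvin, hzR] at *
      gcongr
    linarith [hnonneg z hz]
  -- The barrier stays below η on the half ball of radius R. Since W reaches -2η at its minimum, the
  -- minimum lies on neither sphere: W > -2η on the outer one and W > -η on the inner one.
  obtain ⟨ε, hε, hεη⟩ : ∃ ε > 0, ε * (R ^ (1 - a) + R ^ (2 : ℝ)) < η := by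
    have : 0 < R ^ (1 - a) + R ^ (2 : ℝ) := by positivity
    refine ⟨η / (2 * (R ^ (1 - a) + R ^ (2 : ℝ))), by positivity, ?_⟩
    rw [div_mul_eq_mul_div, div_lt_iff₀ (by positivity)]
    nlinarith
  set W : EuclideanSpace ℝ (Fin n) → ℝ := fun z =>
    u z - M * kelvin k μ x₀ u z - ε * (z N ^ (1 - a) + z N ^ (2 : ℝ)) with hW
  set S : Set (EuclideanSpace ℝ (Fin n)) :=
    {z | 0 ≤ z N ∧ μ ≤ ‖z - x₀‖ ^ 2 ∧ ‖z - x₀‖ ≤ R} with hS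
  have hScomp : IsCompact S := by
    refine Metric.isCompact_of_isClosed_isBounded ?_ ?_
    · have c1 : Continuous fun z : EuclideanSpace ℝ (Fin n) => ‖z - x₀‖ := by fun_prop
      exact (isClosed_le continuous_const hcN).inter
        ((isClosed_le continuous_const (c1.pow 2)).inter (isClosed_le c1 continuous_const))
    · exact Metric.isBounded_closedBall.subset fun z hz => by
        simpa [dist_eq_norm] using hz.2.2
  have hWc : ContinuousOn W S := by
    have hne : ∀ z ∈ S, ‖z - x₀‖ ^ 2 ≠ 0 := fun z hz => (hμ.trans_le hz.2.1).ne'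
    have h1 : ContinuousOn (fun z => x₀ + (μ / ‖z - x₀‖ ^ 2) • (z - x₀)) S :=
      continuousOn_const.add (ContinuousOn.smul
        (continuousOn_const.div (by fun_prop) hne) (by fun_prop))
    have h2 : ContinuousOn (kelvin k μ x₀ u) S :=
      (ContinuousOn.rpow_const (by fun_prop) fun z hz => Or.inl (hne z hz)).mul
        (hcont.comp h1 fun z hz => hinvN hz.1)
    have h3 : Continuous fun z : EuclideanSpace ℝ (Fin n) => z N ^ (1 - a) + z N ^ (2 : ℝ) :=
      (hcN.rpow_const fun _ => Or.inr (by linarith)).add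
        (hcN.rpow_const fun _ => Or.inr (by norm_num))
    exact ((hcont.mono fun z hz => hz.1).sub (continuousOn_const.mul h2)).sub
      (continuousOn_const.mul h3.continuousOn)
  obtain ⟨p, hpS, hpmin⟩ := hScomp.exists_isMinOn ⟨y, hy, hyμ, hR2.le⟩ hWc
  obtain ⟨hpN, hpμ, hpR⟩ := hpS
  have hpη : W p ≤ -(2 * η) := by
    have h1 : W p ≤ W y := hpmin ⟨hy, hyμ, hR2.le⟩
    have h2 : 0 ≤ ε * (y N ^ (1 - a) + y N ^ (2 : ℝ)) := by positivity
    simp only [hW] at h1 ⊢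
    linarith
  have hpbar : ε * (p N ^ (1 - a) + p N ^ (2 : ℝ)) < η := by
    refine lt_of_le_of_lt ?_ hεη
    have : p N ≤ R := by
      have h1 := PiLp.norm_apply_le (p - x₀) N
      simp only [PiLp.sub_apply, hx₀, sub_zero, Real.norm_eq_abs] at h1
      exact (le_abs_self _).trans (h1.trans hpR)
    gcongr
  have hpR' : ‖p - x₀‖ < R := by
    refine hpR.lt_of_ne fun h => ?_
    have := hfar hpN h
    simp only [hW] at hpη
    linarith
  have hpμ' : μ < ‖p - x₀‖ ^ 2 := by
    refine hpμ.lt_of_ne fun h => ?_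
    have : u p - M * kelvin k μ x₀ u p = 0 := by
      rw [kelvin, ← h, div_self hμ.ne', one_smul, add_sub_cancel, ← mul_assoc, hM,
        ← Real.rpow_add hμ, show k / 2 + -k / 2 = 0 by ring, Real.rpow_zero, one_mul, sub_self]
    simp only [hW] at hpη
    linarith
  have hnear : ∀ᶠ z in 𝓝 p, μ < ‖z - x₀‖ ^ 2 ∧ ‖z - x₀‖ < R := by
    have c1 : Continuous fun z : EuclideanSpace ℝ (Fin n) => ‖z - x₀‖ ^ 2 := by fun_prop
    have c2 : Continuous fun z : EuclideanSpace ℝ (Fin n) => ‖z - x₀‖ := by fun_prop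
    exact (c1.continuousAt.eventually (lt_mem_nhds hpμ')).and
      (c2.continuousAt.eventually (gt_mem_nhds hpR'))
  rcases hpN.lt_or_eq with hpos | hzero
  · -- interior minimum
    have hmin : IsLocalMin W p := by
      filter_upwards [hnear, hcN.continuousAt.eventually (lt_mem_nhds hpos)] with z hz hzN
      exact hpmin ⟨hzN.le, hz.1.le, hz.2.le⟩
    have hξN : 0 < (x₀ + (μ / ‖p - x₀‖ ^ 2) • (p - x₀)) N := by
      simp only [PiLp.add_apply, PiLp.smul_apply, PiLp.sub_apply, hx₀, smul_eq_mul, sub_zero,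
        zero_add]
      have := hμ.trans hpμ'
      positivity
    -- Both u and its transform solve the equation, so only the barrier contributes, with the
    -- strictly negative value -2ε(1 + a) p_N.
    have hL := ((HasWeightedLaplacian.of_contDiffAt (a := a) (N := N) (hu2 p hpos)).sub
      ((HasWeightedLaplacian.kelvin (k := k) (μ := μ) hk hx₀ hpos rfl (hu2 _ hξN)
        (heq _ hξN)).const_mul M)).sub ((HasWeightedLaplacian.barrier (a := a) hpos).const_mul ε)
    have := hL.nonneg_of_isLocalMin hpN hmin
    rw [heq p hpos] at this
    have : 0 < ε * (2 * (1 + a) * p N) := by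
      have : 0 < 1 + a := by linarith
      positivity
    linarith
  · -- minimum on the flat boundary
    have hne : p ≠ x₀ := by
      rintro rfl
      simp at hpμ'
      linarith
    have ho := (hbd p hzero.symm).sub ((kelvin_vertical_isLittleO (k := k) ha ha' hμ hlip hbd hx₀
      hzero.symm hne).const_mul_left M)
    have htend : Tendsto (fun t : ℝ => p + t • EuclideanSpace.single N (1 : ℝ)) (𝓝[>] 0) (𝓝 p) := by
      have : Continuous fun t : ℝ => p + t • EuclideanSpace.single N (1 : ℝ) := by fun_prop
      have := this.tendsto 0
      rw [zero_smul, add_zero] at this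
      exact this.mono_left nhdsWithin_le_nhds
    -- On moving up by t, u minus its transform gains at most (ε/2) t^(1-a), while the barrier
    -- removes more than ε t^(1-a): W falls below its minimum.
    obtain ⟨t, ht1, ht2, ht3⟩ := ((isLittleO_iff.1 ho (half_pos hε)).and
      ((htend.eventually hnear).and eventually_mem_nhdsWithin)).exists
    have ht0 : 0 < t := ht3
    have hN : (p + t • EuclideanSpace.single N (1 : ℝ)) N = t := by simp [← hzero]
    have hmin : W p ≤ W (p + t • EuclideanSpace.single N (1 : ℝ)) :=
      hpmin ⟨by rw [hN]; exact ht0.le, ht2.1.le, ht2.2.le⟩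
    have hp1 := Real.rpow_pos_of_pos ht0 (1 - a)
    have hp2 := Real.rpow_pos_of_pos ht0 2
    rw [Real.norm_of_nonneg hp1.le] at ht1
    have ht4 := (le_abs_self _).trans ht1
    simp only [hW, hN, ← hzero, Real.zero_rpow (by linarith : 1 - a ≠ 0),
      Real.zero_rpow (two_ne_zero (α := ℝ)), add_zero, mul_zero, sub_zero] at hmin
    nlinarith [mul_pos hε hp1, mul_pos hε hp2]

/-! ### Dependence on the height alone, and reduction to an ODE. -/

/-- A Harnack type inequality across heights, from the comparison with Kelvin transforms. -/
theorem rpow_mul_le {n : ℕ} {k : ℝ} {N : Fin n} {u : EuclideanSpace ℝ (Fin n) → ℝ}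
    (hkel : ∀ μ > 0, ∀ x₀ y : EuclideanSpace ℝ (Fin n), x₀ N = 0 → 0 ≤ y N → μ ≤ ‖y - x₀‖ ^ 2 →
      μ ^ (k / 2) * kelvin k μ x₀ u y ≤ u y)
    {y z : EuclideanSpace ℝ (Fin n)} (hy : 0 < y N) (hyz : y N < z N) :
    (y N / z N) ^ (k / 2) * u y ≤ u z := by
  have hz : 0 < z N := hy.trans hyz
  set s := y N / z N with hs
  have hs0 : 0 < s := div_pos hy hz
  have hs1 : s < 1 := (div_lt_one hz).2 hyz
  -- The point where the line through y and z meets the boundary hyperplane.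
  set x₀ : EuclideanSpace ℝ (Fin n) := (1 - s)⁻¹ • (y - s • z) with hx₀
  have hx₀N : x₀ N = 0 := by
    have : s * z N = y N := by rw [hs]; field_simp
    simp [hx₀, this]
  have hsx : y = x₀ + s • (z - x₀) := by
    have h1 : (1 - s) • x₀ = y - s • z := by
      rw [hx₀, smul_smul, mul_inv_cancel₀ (by linarith), one_smul]
    rw [sub_smul, one_smul] at h1
    rw [smul_sub, ← sub_eq_zero]
    rw [← sub_eq_zero] at h1
    rw [← neg_eq_zero, ← h1]
    abel
  have hne : z - x₀ ≠ 0 := fun h => by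
    have := congrArg (fun v : EuclideanSpace ℝ (Fin n) => v N) h
    simp [hx₀N] at this
    exact hz.ne' this
  have hρ : 0 < ‖z - x₀‖ ^ 2 := by positivity
  -- With this μ the inversion sends z to y, and s < 1 places z outside the sphere. The prefactor
  -- collapses to s^(k/2).
  have h := hkel (s * ‖z - x₀‖ ^ 2) (by positivity) x₀ z hx₀N hz.le (by nlinarith)
  rw [kelvin, mul_div_assoc, div_self hρ.ne', mul_one, ← hsx, ← mul_assoc,
    Real.mul_rpow hs0.le hρ.le, mul_assoc (s ^ (k / 2)), ← Real.rpow_add hρ,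
    show k / 2 + -k / 2 = 0 by ring, Real.rpow_zero, mul_one] at h
  exact h

/-- A function satisfying the inequality of `rpow_mul_le` depends on the height only. -/
theorem eq_of_height_eq {n : ℕ} {k : ℝ} {N : Fin n} {u : EuclideanSpace ℝ (Fin n) → ℝ}
    (hcont : ∀ x, 0 < x N → ContinuousAt u x)
    (hle : ∀ y z : EuclideanSpace ℝ (Fin n), 0 < y N → y N < z N →
      (y N / z N) ^ (k / 2) * u y ≤ u z)
    {y z : EuclideanSpace ℝ (Fin n)} (hy : 0 < y N) (hyz : y N = z N) : u y = u z := by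
  have key {y z : EuclideanSpace ℝ (Fin n)} (hy : 0 < y N) (hyz : y N = z N) : u y ≤ u z := by
    -- The inequality needs distinct heights, so z is raised by t and then t tends to 0.
    have hN (t : ℝ) : (z + t • EuclideanSpace.single N (1 : ℝ)) N = y N + t := by simp [hyz]
    have h1 : Tendsto (fun t : ℝ => u (z + t • EuclideanSpace.single N (1 : ℝ))) (𝓝[>] 0)
        (𝓝 (u z)) := by
      have hc : Continuous fun t : ℝ => z + t • EuclideanSpace.single N (1 : ℝ) := by fun_prop
      have hc0 := hc.tendsto 0
      rw [zero_smul, add_zero] at hc0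
      exact (hcont z (hyz ▸ hy)).tendsto.comp (hc0.mono_left nhdsWithin_le_nhds)
    have h2 : Tendsto (fun t : ℝ => (y N / (y N + t)) ^ (k / 2) * u y) (𝓝[>] 0) (𝓝 (u y)) := by
      have hc : ContinuousAt (fun t : ℝ => (y N / (y N + t)) ^ (k / 2) * u y) 0 := by
        refine (ContinuousAt.rpow_const (continuousAt_const.div (by fun_prop) (by simpa using hy.ne'))
          (Or.inl ?_)).mul continuousAt_const
        simp [hy.ne']
      have := hc.tendsto
      simp only [add_zero, div_self hy.ne', Real.one_rpow, one_mul] at this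
      exact this.mono_left nhdsWithin_le_nhds
    refine le_of_tendsto_of_tendsto h2 h1 ?_
    filter_upwards [self_mem_nhdsWithin] with t (ht : 0 < t)
    have := hle y (z + t • EuclideanSpace.single N (1 : ℝ)) hy (by rw [hN]; linarith)
    rwa [hN] at this
  exact le_antisymm (key hy hyz) (key (hyz ▸ hy) hyz.symm)

/-- A solution depending on the height only and satisfying the weighted Neumann condition is
constant along the vertical axis. -/
theorem vertical_const {n : ℕ} {a : ℝ} {N : Fin n} {u : EuclideanSpace ℝ (Fin n) → ℝ}
    (hu2 : ∀ x, 0 < x N → ContDiffAt ℝ 2 u x)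
    (hheight : ∀ y z : EuclideanSpace ℝ (Fin n), 0 < y N → y N = z N → u y = u z)
    (heq : ∀ x, 0 < x N → x N * ∑ i, fderiv ℝ (fderiv ℝ u) x (EuclideanSpace.single i 1)
      (EuclideanSpace.single i 1) + a * fderiv ℝ u x (EuclideanSpace.single N 1) = 0)
    (hbdry : Tendsto (fun t : ℝ => t ^ a * partialDeriv N u (t • EuclideanSpace.single N (1 : ℝ)))
      (𝓝[>] 0) (𝓝 0)) {s t : ℝ} (hs : 0 < s) (ht : 0 < t) :
    u (s • EuclideanSpace.single N (1 : ℝ)) = u (t • EuclideanSpace.single N (1 : ℝ)) := by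
  set e : EuclideanSpace ℝ (Fin n) := EuclideanSpace.single N 1 with he
  have hN (t : ℝ) : (t • e) N = t := by simp [he]
  -- Since u is constant on horizontal lines, only the vertical second derivative survives, leaving
  -- an ODE in t.
  have hsecond (x : EuclideanSpace ℝ (Fin n)) (hx : 0 < x N) (i : Fin n) (hi : i ≠ N) :
      fderiv ℝ (fderiv ℝ u) x (EuclideanSpace.single i 1) (EuclideanSpace.single i 1) = 0 := by
    have h1 := HasDeriv2At.comp (u := u) (by simpa using hu2 x hx)
      (HasDeriv2At.affine x (EuclideanSpace.single i (1 : ℝ)) (x := 0))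
    have h2 : (fun s : ℝ => u (x + s • EuclideanSpace.single i (1 : ℝ))) = fun _ => u x := by
      funext s
      exact (hheight _ _ hx (by simp [Ne.symm hi])).symm
    rw [h2] at h1
    simpa using (h1.unique (HasDeriv2At.const (u x))).2
  have hline (t : ℝ) (ht : 0 < t) : HasDeriv2At (fun t : ℝ => u (t • e))
      (fderiv ℝ u (t • e) e) (fderiv ℝ (fderiv ℝ u) (t • e) e e) t := by
    have h1 := HasDeriv2At.comp (u := u) (x := t) (by simpa using hu2 (t • e) (by rwa [hN]))
      (HasDeriv2At.affine 0 e)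
    simpa using h1
  have hode (t : ℝ) (ht : 0 < t) :
      t * fderiv ℝ (fderiv ℝ u) (t • e) e e + a * fderiv ℝ u (t • e) e = 0 := by
    have := heq (t • e) (by rwa [hN])
    rw [Finset.sum_eq_single N (fun i _ hi => hsecond _ (by rwa [hN]) i hi) (by simp), hN] at this
    exact this
  have hflux (t : ℝ) (ht : 0 < t) :
      HasDerivAt (fun t : ℝ => t ^ a * fderiv ℝ u (t • e) e) 0 t := by
    have hd : DifferentiableAt ℝ (fderiv ℝ u) (t • e) :=
      ((hu2 (t • e) (by rwa [hN])).fderiv_right (m := 1) (by norm_num)).differentiableAt (by simp)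
    have hl : HasDerivAt (fun t : ℝ => t • e) e t := by
      simpa using (hasDerivAt_id t).smul_const e
    have hD : HasDerivAt (fun t : ℝ => fderiv ℝ u (t • e) e)
        (fderiv ℝ (fderiv ℝ u) (t • e) e e) t := by
      have hD' : HasFDerivAt (fun x => fderiv ℝ u x e) ((fderiv ℝ (fderiv ℝ u) (t • e)).flip e)
          (t • e) := by
        simpa using hd.hasFDerivAt.clm_apply (hasFDerivAt_const e (t • e))
      exact hD'.comp_hasDerivAt t hl
    refine ((Real.hasDerivAt_rpow_const (p := a) (Or.inl ht.ne')).mul hD).congr_deriv ?_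
    have h2 : t ^ a = t ^ (a - 1) * t := by rw [← Real.rpow_add_one ht.ne']; ring_nf
    rw [h2]
    linear_combination t ^ (a - 1) * hode t ht
  have hzero (t : ℝ) (ht : 0 < t) : fderiv ℝ u (t • e) e = 0 := by
    obtain ⟨c, hc⟩ := isOpen_Ioi.exists_is_const_of_deriv_eq_zero (s := Set.Ioi (0 : ℝ))
      isPreconnected_Ioi (fun t ht => (hflux t ht).differentiableAt.differentiableWithinAt)
      fun t ht => (hflux t ht).deriv
    have hc0 : c = 0 := by
      refine tendsto_nhds_unique (Tendsto.congr' ?_ hbdry) tendsto_const_nhds |>.symm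
      filter_upwards [self_mem_nhdsWithin] with t ht using hc t ht
    exact (mul_eq_zero.1 ((hc t ht).trans hc0)).resolve_left (Real.rpow_pos_of_pos ht a).ne'
  exact isOpen_Ioi.is_const_of_deriv_eq_zero (s := Set.Ioi (0 : ℝ)) (f := fun t : ℝ => u (t • e))
    isPreconnected_Ioi
    (fun t ht => (hline t ht).hasDerivAt.differentiableAt.differentiableWithinAt)
    (fun t ht => (hline t ht).hasDerivAt.deriv.trans (hzero t ht)) hs ht

/-- The open half space is dense in the closed one. -/
theorem closedUpper_subset_closure_upper (n : ℕ) (hn : 2 ≤ n) :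
    closedUpper n hn ⊆ closure (upper n hn) := by
  intro x hx
  have hc : Continuous fun t : ℝ => x + t • EuclideanSpace.single (lastIdx n hn) (1 : ℝ) := by
    fun_prop
  have h0 := hc.tendsto 0
  rw [zero_smul, add_zero] at h0
  refine mem_closure_of_tendsto (h0.mono_left nhdsWithin_le_nhds) (b := 𝓝[>] (0 : ℝ)) ?_
  filter_upwards [self_mem_nhdsWithin] with t (ht : 0 < t)
  have hx' : 0 ≤ x (lastIdx n hn) := hx
  change 0 < (x + t • EuclideanSpace.single (lastIdx n hn) (1 : ℝ)) (lastIdx n hn)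
  simp only [PiLp.add_apply, PiLp.smul_apply, PiLp.single_apply, if_true,
    smul_eq_mul, mul_one]
  linarith

end HalfSpace

end

/-! ### Conclusion. -/

theorem theorem1p2 (n : ℕ) (hn : 2 ≤ n) (a : ℝ)
    (ha : max (-1) (2 - (n : ℝ)) < a) (ha' : a < 1)
    (u : EuclideanSpace ℝ (Fin n) → ℝ)
    (hu2 : ContDiffOn ℝ 2 u (HalfSpace.upper n hn))
    (hu1 : ContDiffOn ℝ 1 u (HalfSpace.closedUpper n hn))
    (hpos : ∀ x ∈ HalfSpace.upper n hn, 0 < u x)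
    (heq : ∀ x ∈ HalfSpace.upper n hn,
      HalfSpace.divergence (fun y => (y (HalfSpace.lastIdx n hn)) ^ a • gradient u y) x = 0)
    (hbdry : ∀ x : EuclideanSpace ℝ (Fin n), x (HalfSpace.lastIdx n hn) = 0 →
      Tendsto
        (fun t : ℝ => t ^ a * HalfSpace.partialDeriv (HalfSpace.lastIdx n hn) u
          (x + t • EuclideanSpace.single (HalfSpace.lastIdx n hn) (1 : ℝ)))
        (𝓝[>] 0) (𝓝 0)) :
    ∃ C : ℝ, 0 < C ∧ ∀ x ∈ HalfSpace.closedUpper n hn, u x = C := by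
  set N := HalfSpace.lastIdx n hn
  have hcN : Continuous fun z : EuclideanSpace ℝ (Fin n) => z N := by fun_prop
  have hopen : IsOpen (HalfSpace.upper n hn) := isOpen_lt continuous_const hcN
  have hconv : Convex ℝ (HalfSpace.closedUpper n hn) :=
    convex_halfSpace_ge (f := fun z : EuclideanSpace ℝ (Fin n) => z N)
      ⟨fun _ _ => rfl, fun _ _ => rfl⟩ 0
  have hclosure := HalfSpace.closedUpper_subset_closure_upper n hn
  have hC2 : ∀ x, 0 < x N → ContDiffAt ℝ 2 u x := fun x hx =>
    hu2.contDiffAt (hopen.mem_nhds hx)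
  have hlip : LocallyLipschitzOn {x | 0 ≤ x N} u := hu1.locallyLipschitzOn hconv
  have hcont : ContinuousOn u {x | 0 ≤ x N} := hlip.continuousOn
  have hsub : HalfSpace.upper n hn ⊆ {x | 0 ≤ x N} := by
    intro x hx
    exact (show 0 < x N from hx).le
  -- Positivity is known only in the open half space; by density and continuity it passes to the
  -- boundary as nonnegativity.
  have hnonneg : ∀ x, 0 ≤ x N → 0 ≤ u x := fun x hx =>
    closure_minimal (t := Set.Ici (0 : ℝ)) (Set.image_subset_iff.2 fun y hy => (hpos y hy).le)
      isClosed_Ici (((hcont x hx).mono hsub).mem_closure_image (hclosure hx))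
  have heq' : ∀ x : EuclideanSpace ℝ (Fin n), 0 < x N → _ := fun x hx =>
    HalfSpace.nondivergence_form hx (hC2 x hx) (heq x hx)
  have hbd := fun (x : EuclideanSpace ℝ (Fin n)) (hx : x N = 0) =>
    HalfSpace.vertical_isLittleO ha' (fun y hy => (hC2 y hy).differentiableAt (by simp)) hcont hx
      (hbdry x hx)
  have hheight : ∀ y z : EuclideanSpace ℝ (Fin n), 0 < y N → y N = z N → u y = u z :=
    fun y z => HalfSpace.eq_of_height_eq (k := n - 2 + a) (fun x hx => (hC2 x hx).continuousAt)
      fun y z => HalfSpace.rpow_mul_le fun μ hμ x₀ y hx₀ hy hyμ =>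
        HalfSpace.kelvin_le ((le_max_left _ _).trans_lt ha) ha' rfl
          (by linarith [(le_max_right (-1) (2 - (n : ℝ))).trans_lt ha]) hμ hC2 hlip hnonneg heq'
          hbd hx₀ hy hyμ
  have hbdry0 : Tendsto (fun t : ℝ => t ^ a * HalfSpace.partialDeriv N u
      (t • EuclideanSpace.single N (1 : ℝ))) (𝓝[>] 0) (𝓝 0) := by
    simpa using hbdry 0 rfl
  have hN (t : ℝ) : (t • EuclideanSpace.single N (1 : ℝ)) N = t := by simp
  have hconst : ∀ x ∈ HalfSpace.upper n hn,
      u x = u ((1 : ℝ) • EuclideanSpace.single N (1 : ℝ)) := fun x hx =>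
    (hheight x (x N • EuclideanSpace.single N (1 : ℝ)) hx (hN _).symm).trans
      (HalfSpace.vertical_const hC2 hheight heq' hbdry0 hx one_pos)
  refine ⟨u ((1 : ℝ) • EuclideanSpace.single N (1 : ℝ)),
    hpos _ ((hN 1).symm ▸ one_pos : 0 < ((1 : ℝ) • EuclideanSpace.single N (1 : ℝ)) N), fun x hx => ?_⟩
  exact closure_minimal (t := {u ((1 : ℝ) • EuclideanSpace.single N (1 : ℝ))})
    (Set.image_subset_iff.2 hconst) isClosed_singleton
    (((hcont x hx).mono hsub).mem_closure_image (hclosure hx))
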